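/- Let $E$ and $F$ be complex Banach spaces, let $U\subseteq E$ be open, and let $v\colon U\to(0,\infty)$ be continuous. For a complex Banach space $G$, let $\mathcal H_v^\infty(U,G)$ be the Banach space of all holomorphic mappings $f\colon U\to G$ with $\|f\|_v:=\sup_{x\in U}v(x)\|f(x)\|<\infty$, and write $\mathcal H_v^\infty(U)=\mathcal H_v^\infty(U,\mathbb C)$. Let $p\in[1,\infty)$ and let $p^*\in(1,\infty]$ be its conjugate index. For a complex Banach space $X$, let $\ell_p(X)$ be the space of sequences in $X$ with $\|(x_n)\|_p=\big(\sum_n\|x_n\|^p\big)^{1/p}<\infty$, and let $\ell^w_{p^*}(X)$ be the space of sequences in $X$ with $\|(x_n)\|^w_{p^*}=\sup_{x^*\in B_{X^*}}\|(x^*(x_n))\|_{\ell_{p^*}}<\infty$. For $(x_n)\in\ell_p(F)$ put $$p\text{-}\mathrm{conv}(x_n)=\Big\{\sum_{n=1}^\infty a_nx_n\colon (a_n)\in B\Big\},$$ where $B$ is the closed unit ball of $\ell_{p^*}$ if $p>1$, and the closed unit ball of $c_0$ if $p=1$. A set $K\subseteq F$ is relatively $p$-compact if $K\subseteq p\text{-}\mathrm{conv}(x_n)$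 for some $(x_n)\in\ell_p(F)$, and then $m_{\mathcal K_p}(K)$ denotes the infimum of $\|(x_n)\|_p$ over all such $(x_n)$. Let $\mathcal H^\infty_{v\mathcal K_p}(U,F)$ be the set of all $f\in\mathcal H^\infty_v(U,F)$ whose $v$-range $(vf)(U)=\{v(x)f(x)\colon x\in U\}$ is relatively $p$-compact, and put $\|f\|_{\mathcal H^\infty_{v\mathcal K_p}}=m_{\mathcal K_p}((vf)(U))$. A mapping $f\in\mathcal H^\infty_v(U,F)$ is right $p$-nuclear if there are $(g_n)\in\ell^w_{p^*}(\mathcal H^\infty_v(U))$ and $(y_n)\in\ell_p(F)$ such that $f=\sum_{n=1}^\infty g_n\cdot y_n$ with convergence in the norm $\|\cdot\|_v$, where $(g_n\cdot y_n)(x)=g_n(x)y_n$. Let $\mathcal H^\infty_{v\mathcal N^p}(U,F)$ be the set of these mappings, and let $\|f\|_{\mathcal H^\infty_{v\mathcal N^p}}$ be the infimum of $\|(g_n)\|^w_{p^*}\|(y_n)\|_p$ over all such representations of $f$. Then $\mathcal H^\infty_{v\mathcal N^p}(U,F)\subseteq\mathcal H^\infty_{v\mathcal K_p}(U,F)$,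 that is, every right $p$-nuclear weighted holomorphic mapping has relatively $p$-compact $v$-range, and $$\|f\|_{\mathcal H^\infty_{v\mathcal K_p}}\le\|f\|_{\mathcal H^\infty_{v\mathcal N^p}}\qquad\text{for all } f\in\mathcal H^\infty_{v\mathcal N^p}(U,F).$$ -/

import Mathlib

open Set Filter Topology
open scoped ENNReal

universe u w

noncomputable section

/-- A weight on an open set `U`: a strictly positive continuous function on `U`. -/
structure Weight {E : Type u} [NormedAddCommGroup E] [NormedSpace ℂ E]
    (U : TopologicalSpace.Opens E) where
  toFun : U → ℝ
  continuous_toFun : Continuous toFun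
  pos : ∀ x, 0 < toFun x

/-- A map `f : U → F` on an open set of a complex normed space is holomorphic if it is the
restriction to `U` of a map that is complex (Fréchet) differentiable at every point of `U`. -/
def IsHolomorphic {E : Type u} {F : Type w} [NormedAddCommGroup E] [NormedSpace ℂ E]
    [NormedAddCommGroup F] [NormedSpace ℂ F] {U : TopologicalSpace.Opens E}
    (f : U → F) : Prop :=
  ∃ g : E → F, DifferentiableOn ℂ g (U : Set E) ∧ ∀ x : U, g x = f x

namespace WeightedHol

section Space

variable {E : Type u} [NormedAddCommGroup E] [NormedSpace ℂ E]
  {U : TopologicalSpace.Opens E} (v : Weight U)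
  (F : Type w) [NormedAddCommGroup F] [NormedSpace ℂ F]

/-- The vector space of all holomorphic `f : U → F` with `sup_{x ∈ U} v(x) ‖f(x)‖ < ∞`. -/
def submodule : Submodule ℂ (U → F) where
  carrier := {f | IsHolomorphic f ∧ BddAbove (range fun x : U => v.toFun x * ‖f x‖)}
  zero_mem' := ⟨⟨0, differentiableOn_const 0, fun _ => rfl⟩, 0, by
    rintro _ ⟨x, rfl⟩; simp⟩
  add_mem' := by
    rintro f g ⟨⟨f', hf, hf'⟩, A, hA⟩ ⟨⟨g', hg, hg'⟩, B, hB⟩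
    refine ⟨⟨f' + g', hf.add hg, fun x => by simp [hf', hg']⟩, A + B, ?_⟩
    rintro _ ⟨x, rfl⟩
    have h1 := hA (mem_range_self x)
    have h2 := hB (mem_range_self x)
    have h3 := mul_le_mul_of_nonneg_left (norm_add_le (f x) (g x)) (v.pos x).le
    simp only [Pi.add_apply]
    linarith
  smul_mem' := by
    rintro c f ⟨⟨f', hf, hf'⟩, A, hA⟩
    refine ⟨⟨c • f', hf.const_smul c, fun x => by simp [hf']⟩, ‖c‖ * A, ?_⟩
    rintro _ ⟨x, rfl⟩
    have h1 := mul_le_mul_of_nonneg_left (hA (mem_range_self x)) (norm_nonneg c)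
    simp only [Pi.smul_apply, norm_smul]
    linarith

end Space

end WeightedHol

/-- The space `𝓗_v^∞(U, F)` of weighted holomorphic mappings. -/
def WeightedHol {E : Type u} [NormedAddCommGroup E] [NormedSpace ℂ E]
    {U : TopologicalSpace.Opens E} (v : Weight U)
    (F : Type w) [NormedAddCommGroup F] [NormedSpace ℂ F] : Type (max u w) :=
  WeightedHol.submodule v F

namespace WeightedHol

section Space

variable {E : Type u} [NormedAddCommGroup E] [NormedSpace ℂ E]
  {U : TopologicalSpace.Opens E} {v : Weight U}
  {F : Type w} [NormedAddCommGroup F] [NormedSpace ℂ F]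

instance : AddCommGroup (WeightedHol v F) :=
  inferInstanceAs (AddCommGroup (WeightedHol.submodule v F))

instance : Module ℂ (WeightedHol v F) :=
  inferInstanceAs (Module ℂ (WeightedHol.submodule v F))

instance : CoeFun (WeightedHol v F) (fun _ => U → F) := ⟨fun f => f.1⟩

/-- The weighted supremum norm `‖f‖_v = sup_{x ∈ U} v(x) ‖f(x)‖`. -/
instance : Norm (WeightedHol v F) := ⟨fun f => ⨆ x : U, v.toFun x * ‖f x‖⟩

theorem norm_def (f : WeightedHol v F) : ‖f‖ = ⨆ x : U, v.toFun x * ‖f x‖ := rfl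

theorem le_norm (f : WeightedHol v F) (x : U) : v.toFun x * ‖f x‖ ≤ ‖f‖ :=
  le_ciSup f.2.2 x

theorem norm_nonneg' (f : WeightedHol v F) : 0 ≤ ‖f‖ :=
  Real.iSup_nonneg fun x => mul_nonneg (v.pos x).le (norm_nonneg _)

theorem norm_le' {f : WeightedHol v F} {C : ℝ} (hC : 0 ≤ C)
    (h : ∀ x : U, v.toFun x * ‖f x‖ ≤ C) : ‖f‖ ≤ C :=
  Real.iSup_le h hC

theorem core : NormedSpace.Core ℂ (WeightedHol v F) where
  norm_nonneg := norm_nonneg'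
  norm_smul c f := by
    rw [norm_def, norm_def, Real.mul_iSup_of_nonneg (norm_nonneg c)]
    refine iSup_congr fun x => ?_
    have : (c • f) x = c • f x := rfl
    rw [this, norm_smul]
    ring
  norm_triangle f g := by
    refine norm_le' (add_nonneg (norm_nonneg' f) (norm_nonneg' g)) fun x => ?_
    have h1 := le_norm f x
    have h2 := le_norm g x
    have h3 := mul_le_mul_of_nonneg_left (norm_add_le (f x) (g x)) (v.pos x).le
    have h4 : (f + g) x = f x + g x := rfl
    rw [h4]
    linarith
  norm_eq_zero_iff f := by
    constructor
    · intro h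
      refine Subtype.ext (funext fun x => ?_)
      have h1 := le_norm f x
      rw [h] at h1
      have h2 : ‖f x‖ ≤ 0 := by
        by_contra h3
        exact absurd h1 (not_le.mpr (mul_pos (v.pos x) (not_le.mp h3)))
      exact norm_le_zero_iff.mp h2
    · rintro rfl
      refine le_antisymm (norm_le' le_rfl fun x => ?_) (norm_nonneg' _)
      have : (0 : WeightedHol v F) x = 0 := rfl
      rw [this]
      simp

instance : NormedAddCommGroup (WeightedHol v F) := NormedAddCommGroup.ofCore core

instance : NormedSpace ℂ (WeightedHol v F) := NormedSpace.ofCore core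

/-- For `g ∈ 𝓗_v^∞(U)` and `y ∈ F`, the mapping `g · y : x ↦ g(x) y`. -/
def dot (g : WeightedHol v ℂ) (y : F) : WeightedHol v F :=
  ⟨fun x => g x • y, by
    obtain ⟨g', hg, hg'⟩ := g.2.1
    refine ⟨⟨fun x => g' x • y, hg.smul_const y, fun x => by simp [hg']⟩, ‖g‖ * ‖y‖, ?_⟩
    rintro _ ⟨x, rfl⟩
    have h1 := mul_le_mul_of_nonneg_right (le_norm g x) (norm_nonneg y)
    simp only [norm_smul]
    linarith⟩

/-- The `v`-range `(vf)(U) = {v(x) f(x) : x ∈ U}`. -/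
def vRange (f : WeightedHol v F) : Set F := range fun x : U => (v.toFun x : ℂ) • f x

end Space

end WeightedHol

section Sequences

/-- The set of values `‖(x*(x_n))‖_q`, for `x*` in the closed unit ball of the dual of `X`. -/
def weakLpValues {X : Type u} [NormedAddCommGroup X] [NormedSpace ℂ X]
    (q : ℝ≥0∞) (x : ℕ → X) : Set ℝ :=
  {r | ∃ φ : StrongDual ℂ X, ‖φ‖ ≤ 1 ∧
    ∃ s : lp (fun _ : ℕ => ℂ) q, (∀ n, s n = φ (x n)) ∧ r = ‖s‖}

/-- `(x_n) ∈ ℓ_q^w(X)`: all the scalar sequences `(x*(x_n))`, `‖x*‖ ≤ 1`, belong to `ℓ_q`, with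
norms bounded uniformly. -/
def MemWeakLp {X : Type u} [NormedAddCommGroup X] [NormedSpace ℂ X]
    (q : ℝ≥0∞) (x : ℕ → X) : Prop :=
  (∀ φ : StrongDual ℂ X, ‖φ‖ ≤ 1 → Memℓp (fun n => φ (x n)) q) ∧ BddAbove (weakLpValues q x)

/-- The weak norm `‖(x_n)‖_q^w = sup_{x* ∈ B_{X*}} ‖(x*(x_n))‖_q`. -/
def weakLpNorm {X : Type u} [NormedAddCommGroup X] [NormedSpace ℂ X]
    (q : ℝ≥0∞) (x : ℕ → X) : ℝ :=
  sSup (weakLpValues q x)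

/-- The admissible coefficients of the `p`-convex hull: the closed unit ball of `ℓ_{p*}`
if `p > 1`, and the closed unit ball of `c_0` if `p = 1`. -/
def hullCoeff (p : ℝ≥0∞) : Set (ℕ → ℂ) :=
  {a | (p = 1 ∧ Tendsto a atTop (𝓝 0) ∧ ∀ n, ‖a n‖ ≤ 1) ∨
    (p ≠ 1 ∧ ∃ s : lp (fun _ : ℕ => ℂ) p.conjExponent, ‖s‖ ≤ 1 ∧ ∀ n, s n = a n)}

/-- The `p`-convex hull `{∑ a_n x_n}` of a sequence `(x_n) ∈ ℓ_p(F)`. -/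
def pConv {F : Type w} [NormedAddCommGroup F] [NormedSpace ℂ F]
    (p : ℝ≥0∞) (x : lp (fun _ : ℕ => F) p) : Set F :=
  {z | ∃ a ∈ hullCoeff p, HasSum (fun n => a n • x n) z}

/-- Relatively `p`-compact sets, `1 ≤ p < ∞`. -/
def IsRelPCompact {F : Type w} [NormedAddCommGroup F] [NormedSpace ℂ F]
    (p : ℝ≥0∞) (K : Set F) : Prop :=
  ∃ x : lp (fun _ : ℕ => F) p, K ⊆ pConv p x

/-- The measure `m_{𝓚_p}(K)` of the size of the `p`-compactness of a relatively `p`-compact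
set `K`, `1 ≤ p < ∞`. -/
def pCompactMeasure {F : Type w} [NormedAddCommGroup F] [NormedSpace ℂ F]
    (p : ℝ≥0∞) (K : Set F) : ℝ :=
  sInf {r | ∃ x : lp (fun _ : ℕ => F) p, K ⊆ pConv p x ∧ r = ‖x‖}

end Sequences

namespace WeightedHol

section Ideals

variable {E : Type u} [NormedAddCommGroup E] [NormedSpace ℂ E]
  {U : TopologicalSpace.Opens E} (v : Weight U)
  (F : Type w) [NormedAddCommGroup F] [NormedSpace ℂ F]

/-- `𝓗_{v𝓚_p}^∞(U, F)`: the weighted holomorphic mappings with relatively `p`-compact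
`v`-range. -/
def pCompactMaps (p : ℝ≥0∞) : Set (WeightedHol v F) := {f | IsRelPCompact p f.vRange}

variable {v F}

/-- `‖f‖_{𝓗_{v𝓚_p}^∞} = m_{𝓚_p}((vf)(U))`. -/
def pCompactNorm (p : ℝ≥0∞) (f : WeightedHol v F) : ℝ := pCompactMeasure p f.vRange

/-- `(g_n)`, `(y_n)` is a right `p`-nuclear weighted holomorphic representation of `f`:
`(g_n) ∈ ℓ_{p*}^w(𝓗_v^∞(U))`, `(y_n) ∈ ℓ_p(F)` and `f = ∑ g_n · y_n` in the norm `‖·‖_v`. -/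
def IsRightNuclearRep (p : ℝ≥0∞) (f : WeightedHol v F)
    (g : ℕ → WeightedHol v ℂ) (y : lp (fun _ : ℕ => F) p) : Prop :=
  MemWeakLp p.conjExponent g ∧
    Tendsto (fun N => ∑ n ∈ Finset.range N, dot (g n) (y n)) atTop (𝓝 f)

variable (v F) in
/-- `𝓗_{v𝓝^p}^∞(U, F)`: the right `p`-nuclear weighted holomorphic mappings. -/
def rightNuclearMaps (p : ℝ≥0∞) : Set (WeightedHol v F) :=
  {f | ∃ g y, IsRightNuclearRep p f g y}

/-- `‖f‖_{𝓗_{v𝓝^p}^∞} = inf ‖(g_n)‖_{p*}^w ‖(y_n)‖_p`, over all representations of `f`. -/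
def rightNuclearNorm (p : ℝ≥0∞) (f : WeightedHol v F) : ℝ :=
  sInf {r | ∃ g y, IsRightNuclearRep p f g y ∧ r = weakLpNorm p.conjExponent g * ‖y‖}

end Ideals

end WeightedHol

end

open WeightedHol

/-! For each `u : U`, the map `f ↦ v(u) f(u)` has norm at most 1. Applied to a representation `f = ∑
gₙ · yₙ`, it gives `v(u) f(u) = ∑ sₙ yₙ`, where `sₙ = v(u) gₙ(u)` has `ℓ_{p*}` norm at most `M`, the
weak norm of `(gₙ)`. The bound `M` does not depend on `u`, so one sequence serves the whole
`v`-range. For `p > 1`, that sequence is `M yₙ`, with coefficients `sₙ / M`. For `p = 1`, the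
coefficients `sₙ / M` are only bounded by 1, while the hull demands null sequences. A null factor
`bₙ ∈ [0, 1]` is therefore moved from `yₙ` to the coefficients: `M bₙ⁻¹ yₙ` is the sequence and `bₙ
sₙ / M` the coefficients (`exists_null_factor_of_summable`). This costs an arbitrary `ε` in the
norm, which disappears in the infimum. -/

/-- A summable nonnegative sequence factors through a null sequence in `[0, 1]` at the cost of an
arbitrarily small increase of its sum. -/
theorem exists_null_factor_of_summable {t : ℕ → ℝ} (ht : ∀ n, 0 ≤ t n) (hs : Summable t)
    {ε : ℝ} (hε : 0 < ε) :
    ∃ b : ℕ → ℝ, (∀ n, 0 ≤ b n ∧ b n ≤ 1) ∧ Tendsto b atTop (𝓝 0) ∧ (∀ n, b n = 0 → t n = 0) ∧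
      Summable (fun n => (b n)⁻¹ * t n) ∧ ∑' n, (b n)⁻¹ * t n ≤ ∑' n, t n + ε := by
  set r : ℕ → ℝ := fun n => ∑' k, t (k + n) with hr
  have hr0 : ∀ n, 0 ≤ r n := fun n => tsum_nonneg fun k => ht _
  have hrt : Tendsto r atTop (𝓝 0) := tendsto_sum_nat_add t
  have hrs : ∀ n, r n = t n + r (n + 1) := fun n => by
    have h := ((summable_nat_add_iff n).2 hs).tsum_eq_zero_add
    simp only [hr, h, zero_add]
    congr 1
    exact tsum_congr fun k => by congr 1; omega
  -- The factor will be `b = q / (q + c)`. Since `t n = q n ^ 2 - q (n + 1) ^ 2`, the excess `c * t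
  -- n / q n` of each term is at most `2 * c * (q n - q (n + 1))`, which telescopes.
  set q : ℕ → ℝ := fun n => √(r n) with hq
  have hq0 : ∀ n, 0 ≤ q n := fun n => Real.sqrt_nonneg _
  have hqq : ∀ n, q n * q n = r n := fun n => Real.mul_self_sqrt (hr0 n)
  have hqt : Tendsto q atTop (𝓝 0) := by simpa using hrt.sqrt
  -- The telescoped excess is at most `2 * c * q 0`; the `+ 1` covers `q 0 = 0`.
  set c : ℝ := ε / (2 * q 0 + 1) with hc
  have hc0 : 0 < c := by have := hq0 0; positivity
  have hcq : 2 * c * q 0 ≤ ε := by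
    have h1 : c * (2 * q 0 + 1) = ε := div_mul_cancel₀ _ (by have := hq0 0; positivity)
    nlinarith
  have hzero : ∀ n, q n = 0 → t n = 0 := fun n h => by
    have h1 := hqq n
    rw [h, hrs n] at h1
    linarith [ht n, hr0 (n + 1)]
  have hmono : ∀ n, q (n + 1) ≤ q n := fun n =>
    Real.sqrt_le_sqrt (by rw [hrs n]; linarith [ht n])
  have hterm : ∀ n, (q n / (q n + c))⁻¹ * t n ≤ t n + 2 * c * (q n - q (n + 1)) := fun n => by
    rcases (hq0 n).eq_or_lt with h | h
    · rw [hzero n h.symm]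
      nlinarith [hmono n]
    · have h1 : t n = (q n - q (n + 1)) * (q n + q (n + 1)) := by
        have := hqq n; have := hqq (n + 1); have := hrs n; nlinarith
      have h2 : t n ≤ 2 * q n * (q n - q (n + 1)) := by
        rw [h1]; nlinarith [hmono n]
      have h3 : (q n / (q n + c))⁻¹ * t n = t n + c * (t n / q n) := by
        field_simp
      have h4 : t n / q n ≤ 2 * (q n - q (n + 1)) := by
        rw [div_le_iff₀ h]; linarith
      rw [h3]
      nlinarith
  have hnn : ∀ n, 0 ≤ (q n / (q n + c))⁻¹ * t n := fun n => by
    have := hq0 n; have := ht n; positivity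
  have hsum : ∀ N, ∑ n ∈ Finset.range N, (q n / (q n + c))⁻¹ * t n ≤ ∑' n, t n + ε := fun N => by
    calc ∑ n ∈ Finset.range N, (q n / (q n + c))⁻¹ * t n
        ≤ ∑ n ∈ Finset.range N, (t n + 2 * c * (q n - q (n + 1))) :=
          Finset.sum_le_sum fun n _ => hterm n
      _ = ∑ n ∈ Finset.range N, t n + 2 * c * (q 0 - q N) := by
          rw [Finset.sum_add_distrib, ← Finset.mul_sum, Finset.sum_range_sub']
      _ ≤ ∑' n, t n + ε := by
          have h1 := hs.sum_le_tsum (Finset.range N) fun n _ => ht n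
          nlinarith [hq0 N]
  refine ⟨fun n => q n / (q n + c), fun n => ?_, ?_, fun n h => ?_,
    summable_of_sum_range_le hnn hsum, Real.tsum_le_of_sum_range_le hnn hsum⟩
  · have := hq0 n
    exact ⟨by positivity, (div_le_one (by positivity)).2 (by linarith)⟩
  · have h := hqt.div (hqt.add_const c) (by simpa using hc0.ne')
    rw [zero_div] at h
    exact h
  · rcases div_eq_zero_iff.1 h with h | h
    · exact hzero n h
    · linarith [hq0 n]

theorem weakLpNorm_nonneg {X : Type u} [NormedAddCommGroup X] [NormedSpace ℂ X]
    (q : ℝ≥0∞) (x : ℕ → X) : 0 ≤ weakLpNorm q x := by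
  refine Real.sSup_nonneg ?_
  rintro _ ⟨_, _, s, _, rfl⟩
  exact lp.norm_nonneg' s

/-! ### Weighted point evaluations -/

namespace WeightedHol

section Evaluation

variable {E : Type u} [NormedAddCommGroup E] [NormedSpace ℂ E]
  {U : TopologicalSpace.Opens E} {v : Weight U}
  {F : Type w} [NormedAddCommGroup F] [NormedSpace ℂ F]

variable (v F) in
/-- The weighted evaluation `f ↦ v(x) f(x)` at a point `x ∈ U`. -/
noncomputable def evalCLM (x : U) : WeightedHol v F →L[ℂ] F :=
  LinearMap.mkContinuous
    { toFun := fun f => (v.toFun x : ℂ) • f x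
      map_add' := fun f g => smul_add _ (f x) (g x)
      map_smul' := fun c f => smul_comm _ c (f x) } 1 fun f => by
    have h := le_norm f x
    simpa [norm_smul, abs_of_pos (v.pos x)] using h

@[simp]
theorem evalCLM_apply (x : U) (f : WeightedHol v F) :
    evalCLM v F x f = (v.toFun x : ℂ) • f x := rfl

theorem norm_evalCLM_le (x : U) : ‖evalCLM v F x‖ ≤ 1 :=
  LinearMap.mkContinuous_norm_le _ zero_le_one _

/-- The weighted values at a point of a weakly `q`-summable sequence form an element of `ℓ_q` whose
norm is at most the weak norm. -/
theorem exists_lp_eval_of_memWeakLp {q : ℝ≥0∞} {g : ℕ → WeightedHol v ℂ} (hg : MemWeakLp q g)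
    (x : U) : ∃ s : lp (fun _ : ℕ => ℂ) q,
      (∀ n, s n = evalCLM v ℂ x (g n)) ∧ ‖s‖ ≤ weakLpNorm q g :=
  ⟨⟨fun n => evalCLM v ℂ x (g n), hg.1 _ (norm_evalCLM_le x)⟩, fun _ => rfl,
    le_csSup hg.2 ⟨_, norm_evalCLM_le x, _, fun _ => rfl, rfl⟩⟩

/-- Weighted evaluation is continuous, so convergence in `‖·‖_v` passes to the values. -/
theorem IsRightNuclearRep.tendsto_eval {p : ℝ≥0∞} {f : WeightedHol v F}
    {g : ℕ → WeightedHol v ℂ} {y : lp (fun _ : ℕ => F) p} (h : IsRightNuclearRep p f g y) (x : U) :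
    Tendsto (fun N => ∑ n ∈ Finset.range N, evalCLM v ℂ x (g n) • y n) atTop
      (𝓝 ((v.toFun x : ℂ) • f x)) := by
  have h1 := ((evalCLM v F x).continuous.tendsto f).comp h.2
  refine h1.congr fun N => ?_
  simp only [Function.comp_apply, map_sum]
  exact Finset.sum_congr rfl fun n _ => (smul_assoc (v.toFun x : ℂ) (g n x) (y n)).symm

end Evaluation

end WeightedHol

/-! ### Enclosing series in a `p`-convex hull -/

section Hulls

variable {F : Type w} [NormedAddCommGroup F] [NormedSpace ℂ F]

/-- Hölder's inequality gives absolute convergence. -/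
theorem lp.summable_smul_of_conjExponent [CompleteSpace F] {p : ℝ≥0∞} (hp : 1 < p) (hp' : p ≠ ⊤)
    (s : lp (fun _ : ℕ => ℂ) p.conjExponent) (y : lp (fun _ : ℕ => F) p) :
    Summable fun n => s n • y n := by
  have hpr : 1 < p.toReal := by
    simpa using (ENNReal.toReal_lt_toReal ENNReal.one_ne_top hp').2 hp
  have hc := (ENNReal.HolderConjugate.toReal_iff hpr).2 (.conjExponent hp.le)
  refine .of_norm ?_
  have hs := (lp.memℓp s).summable hc.symm.pos
  have hy := (lp.memℓp y).summable hc.pos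
  simpa only [norm_smul] using Real.summable_mul_of_Lp_Lq_of_nonneg hc.symm
    (fun n => norm_nonneg (s n)) (fun n => norm_nonneg (y n)) hs hy

/-- The bound `M` is absorbed into the sequence. The witness is chosen before `s` and `z`, so one
hull contains all the sums at once. -/
theorem exists_lp_forall_mem_pConv_of_one_lt [CompleteSpace F] {p : ℝ≥0∞} (hp : 1 < p)
    (hp' : p ≠ ⊤) (y : lp (fun _ : ℕ => F) p) {M : ℝ} (hM : 0 ≤ M) :
    ∃ x : lp (fun _ : ℕ => F) p, ‖x‖ = M * ‖y‖ ∧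
      ∀ (s : lp (fun _ : ℕ => ℂ) p.conjExponent) (z : F), ‖s‖ ≤ M →
        Tendsto (fun N => ∑ n ∈ Finset.range N, s n • y n) atTop (𝓝 z) → z ∈ pConv p x := by
  have hp0 : p ≠ 0 := (zero_lt_one.trans hp).ne'
  have hq0 : p.conjExponent ≠ 0 := by simp [ENNReal.conjExponent]
  have : Fact (1 ≤ p.conjExponent) := ⟨by simp [ENNReal.conjExponent]⟩
  refine ⟨(M : ℂ) • y, by
    rw [lp.norm_const_smul hp0, Complex.norm_real, Real.norm_of_nonneg hM], fun s z hs hz => ?_⟩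
  have hsum := lp.summable_smul_of_conjExponent hp hp' s y
  have hz' : HasSum (fun n => s n • y n) z :=
    tendsto_nhds_unique hz hsum.hasSum.tendsto_sum_nat ▸ hsum.hasSum
  refine ⟨fun n => (M : ℂ)⁻¹ * s n, Or.inr ⟨hp.ne', (M : ℂ)⁻¹ • s, ?_, fun n => rfl⟩, ?_⟩
  · rw [lp.norm_const_smul hq0, norm_inv, Complex.norm_real, Real.norm_of_nonneg hM]
    exact inv_mul_le_one_of_le₀ hs hM
  · refine hz'.congr_fun fun n => ?_
    -- If `M = 0`, then `M⁻¹ = 0` by convention, but `s` vanishes as well.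
    rcases hM.eq_or_lt with h | h
    · have : s n = 0 := norm_le_zero_iff.1 ((lp.norm_apply_le_norm hq0 s n).trans (h ▸ hs))
      simp [this]
    · have hM' : (M : ℂ) ≠ 0 := by exact_mod_cast h.ne'
      rw [lp.coeFn_smul, Pi.smul_apply, smul_smul]
      congr 1
      field_simp

/-- Bounded coefficients become null ones once multiplied by `b`; dividing `y` by `b` compensates
and raises its norm only slightly. -/
theorem exists_lp_forall_mem_pConv_one [CompleteSpace F] (y : lp (fun _ : ℕ => F) 1) {M ε : ℝ}
    (hM : 0 ≤ M) (hε : 0 < ε) :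
    ∃ x : lp (fun _ : ℕ => F) 1, ‖x‖ ≤ M * ‖y‖ + ε ∧
      ∀ (s : ℕ → ℂ) (z : F), (∀ n, ‖s n‖ ≤ M) →
        Tendsto (fun N => ∑ n ∈ Finset.range N, s n • y n) atTop (𝓝 z) → z ∈ pConv 1 x := by
  have hy : HasSum (fun n => ‖y n‖) ‖y‖ := by
    simpa using lp.hasSum_norm (p := 1) (by simp) y
  -- The later scaling by `M` turns the excess `ε / (M + 1)` into at most `ε`, also when `M = 0`.
  obtain ⟨b, hb, hbt, hb0, hbs, hbl⟩ := exists_null_factor_of_summable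
    (fun n => norm_nonneg (y n)) hy.summable (ε := ε / (M + 1)) (by positivity)
  rw [hy.tsum_eq] at hbl
  have hnorm : ∀ n, ‖((b n : ℂ)⁻¹) • y n‖ = (b n)⁻¹ * ‖y n‖ := fun n => by
    rw [norm_smul, norm_inv, Complex.norm_real, Real.norm_of_nonneg (hb n).1]
  let x : lp (fun _ : ℕ => F) 1 := ⟨fun n => ((b n : ℂ)⁻¹) • y n, memℓp_gen (by simpa [hnorm])⟩
  have hx : ‖x‖ ≤ ‖y‖ + ε / (M + 1) := by
    have h1 : HasSum (fun n => ‖x n‖) ‖x‖ := by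
      simpa using lp.hasSum_norm (p := 1) (by simp) x
    rw [← h1.tsum_eq]
    exact (tsum_congr hnorm).trans_le hbl
  refine ⟨(M : ℂ) • x, ?_, fun s z hs hz => ?_⟩
  · rw [lp.norm_const_smul one_ne_zero, Complex.norm_real, Real.norm_of_nonneg hM]
    have h1 : ε / (M + 1) * (M + 1) = ε := div_mul_cancel₀ _ (by positivity)
    have h2 : 0 < ε / (M + 1) := by positivity
    nlinarith [mul_le_mul_of_nonneg_left hx hM]
  · have hsum : Summable fun n => s n • y n :=
      .of_norm_bounded (hy.summable.mul_left M) fun n => by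
        rw [norm_smul]
        exact mul_le_mul_of_nonneg_right (hs n) (norm_nonneg _)
    have hz' : HasSum (fun n => s n • y n) z :=
      tendsto_nhds_unique hz hsum.hasSum.tendsto_sum_nat ▸ hsum.hasSum
    have hsM : ∀ n, ‖(M : ℂ)⁻¹ * s n‖ ≤ 1 := fun n => by
      rw [norm_mul, norm_inv, Complex.norm_real, Real.norm_of_nonneg hM]
      exact inv_mul_le_one_of_le₀ (hs n) hM
    have hab : ∀ n, ‖(b n : ℂ) * ((M : ℂ)⁻¹ * s n)‖ ≤ b n := fun n => by
      rw [norm_mul, Complex.norm_real, Real.norm_of_nonneg (hb n).1]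
      exact mul_le_of_le_one_right (hb n).1 (hsM n)
    refine ⟨fun n => (b n : ℂ) * ((M : ℂ)⁻¹ * s n),
      Or.inl ⟨rfl, squeeze_zero_norm hab hbt, fun n => (hab n).trans (hb n).2⟩, ?_⟩
    refine hz'.congr_fun fun n => ?_
    have hxn : ((M : ℂ) • x) n = (M : ℂ) • (b n : ℂ)⁻¹ • y n := rfl
    rw [hxn]
    rcases hM.eq_or_lt with h | h
    · have : s n = 0 := norm_le_zero_iff.1 (h ▸ hs n)
      simp [this]
    · have hM' : (M : ℂ) ≠ 0 := by exact_mod_cast h.ne'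
      -- Where `b n = 0` nothing can cancel, but there `y n = 0`.
      by_cases hbn : b n = 0
      · simp [norm_eq_zero.1 (hb0 n hbn)]
      · have hb' : (b n : ℂ) ≠ 0 := by exact_mod_cast hbn
        rw [smul_smul, smul_smul]
        congr 1
        field_simp

theorem pCompactMeasure_le {p : ℝ≥0∞} {K : Set F} {x : lp (fun _ : ℕ => F) p}
    (hx : K ⊆ pConv p x) : pCompactMeasure p K ≤ ‖x‖ := by
  refine csInf_le ⟨0, ?_⟩ ⟨x, hx, rfl⟩
  rintro _ ⟨z, _, rfl⟩
  exact lp.norm_nonneg' z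

end Hulls

/-- The `v`-range of a right `p`-nuclear mapping lies in the `p`-convex hull of a sequence whose norm
is almost the product of the norms of a given representation. -/
theorem WeightedHol.IsRightNuclearRep.exists_vRange_subset_pConv
    {E : Type u} [NormedAddCommGroup E] [NormedSpace ℂ E]
    {F : Type w} [NormedAddCommGroup F] [NormedSpace ℂ F] [CompleteSpace F]
    {U : TopologicalSpace.Opens E} {v : Weight U} {p : ℝ≥0∞} (hp : 1 ≤ p) (hp' : p ≠ ⊤)
    {f : WeightedHol v F} {g : ℕ → WeightedHol v ℂ} {y : lp (fun _ : ℕ => F) p}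
    (h : IsRightNuclearRep p f g y) {ε : ℝ} (hε : 0 < ε) :
    ∃ x : lp (fun _ : ℕ => F) p, f.vRange ⊆ pConv p x ∧
      ‖x‖ ≤ weakLpNorm p.conjExponent g * ‖y‖ + ε := by
  have hM := weakLpNorm_nonneg p.conjExponent g
  rcases hp.eq_or_lt with rfl | hp1
  · obtain ⟨x, hx, hmem⟩ := exists_lp_forall_mem_pConv_one y hM hε
    refine ⟨x, ?_, hx⟩
    rintro _ ⟨u, rfl⟩
    obtain ⟨s, hs, hsM⟩ := exists_lp_eval_of_memWeakLp h.1 u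
    refine hmem (fun n => s n) _ (fun n => (lp.norm_apply_le_norm ?_ s n).trans hsM) ?_
    · simp [ENNReal.conjExponent]
    · simpa only [hs] using h.tendsto_eval u
  · obtain ⟨x, hx, hmem⟩ := exists_lp_forall_mem_pConv_of_one_lt hp1 hp' y hM
    refine ⟨x, ?_, hx.le.trans (le_add_of_nonneg_right hε.le)⟩
    rintro _ ⟨u, rfl⟩
    obtain ⟨s, hs, hsM⟩ := exists_lp_eval_of_memWeakLp h.1 u
    exact hmem s _ hsM (by simpa only [hs] using h.tendsto_eval u)

theorem mainTheorem8 {E : Type u} [NormedAddCommGroup E] [NormedSpace ℂ E] [CompleteSpace E]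
    {F : Type w} [NormedAddCommGroup F] [NormedSpace ℂ F] [CompleteSpace F]
    (U : TopologicalSpace.Opens E) (v : Weight U) (p : ℝ≥0∞) (hp : 1 ≤ p) (hp' : p ≠ ⊤) :
    WeightedHol.rightNuclearMaps v F p ⊆ WeightedHol.pCompactMaps v F p ∧
      ∀ f ∈ WeightedHol.rightNuclearMaps v F p,
        WeightedHol.pCompactNorm p f ≤ WeightedHol.rightNuclearNorm p f := by
  refine ⟨?_, ?_⟩
  · rintro f ⟨g, y, h⟩
    obtain ⟨x, hx, -⟩ := h.exists_vRange_subset_pConv hp hp' one_pos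
    exact ⟨x, hx⟩
  · rintro f ⟨g₀, y₀, h₀⟩
    refine le_csInf ⟨_, g₀, y₀, h₀, rfl⟩ ?_
    rintro _ ⟨g, y, h, rfl⟩
    refine le_of_forall_pos_le_add fun ε hε => ?_
    obtain ⟨x, hx, hxn⟩ := h.exists_vRange_subset_pConv hp hp' hε
    exact (pCompactMeasure_le hx).trans hxn
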